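/- Let $\rho>0$, let $M\ge N\ge 1$ be integers and let $c_0,\dots,c_{N-1}>0$ be real. For a complex $N\times N$ matrix $A=(a_{jk})$ and $n\ge 0$ let $A^{\circ n}=(a_{jk}^n)$ be the entrywise power, where $A^{\circ 0}=\mathbf 1_{N\times N}$ is the all-ones matrix. Put $h_{\mathbf c}(z)=\sum_{j=0}^{N-1}c_jz^j$, $h_{\mathbf c}[A]=\sum_{j=0}^{N-1}c_jA^{\circ j}$, $\mathcal K(A)=\ker h_{\mathbf c}[A]\subseteq\mathbb C^N$, and $$\mathcal C(\mathbf c;z^M;N,\rho)=\sum_{j=0}^{N-1}\binom Mj^2\binom{M-j-1}{N-j-1}^2\frac{\rho^{M-j}}{c_j}.$$ For a positive semidefinite (Hermitian) matrix $A$, let $\mathcal C(h_{\mathbf c};z^M;A)$ be the smallest real number $t$ such that $t\,h_{\mathbf c}[A]-A^{\circ M}$ is positive semidefinite. Then: 1. For every positive semidefinite $A\in\mathbb C^{N\times N}$, $\mathcal K(A)=\bigcap_{n\ge0}\ker A^{\circ n}$. 2. For every positive semidefinite $A\in\mathbb C^{N\times N}$ the number $\mathcal C(h_{\mathbf c};z^M;A)$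 exists (is finite), $\mathbf u^*h_{\mathbf c}[A]\mathbf u>0$ for all $\mathbf u\in\mathcal K(A)^\perp\setminus\{\mathbf 0\}$, and $$\mathcal C(h_{\mathbf c};z^M;A)=\sup_{\mathbf u\in\mathcal K(A)^\perp\setminus\{\mathbf 0\}}\frac{\mathbf u^*A^{\circ M}\mathbf u}{\mathbf u^*\bigl(\sum_{j=0}^{N-1}c_jA^{\circ j}\bigr)\mathbf u}.$$ If moreover all entries of $A$ have modulus at most $\rho$, then $\mathcal C(h_{\mathbf c};z^M;A)\le\mathcal C(\mathbf c;z^M;N,\rho)$. 3. This bound is sharp: $\mathcal C(\mathbf c;z^M;N,\rho)$ is the supremum of $\mathcal C(h_{\mathbf c};z^M;A)$ over all positive semidefinite $N\times N$ matrices $A$ with entries in the closed disc of radius $\rho$ about $0$. Moreover, for every $\epsilon\in(0,\rho)$ it is already the supremum of $\mathcal C(h_{\mathbf c};z^M;A)$ over the positive semidefinite $N\times N$ matrices $A$ of rank at most one with all entries real and in $(\rho-\epsilon,\rho)$. -/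

import Mathlib

open scoped ComplexOrder

namespace HadamardRayleigh

/-- The set `𝒫_N^k(I)` of positive semidefinite (Hermitian) `N × N` matrices with all entries in
`I ⊆ ℂ` and of rank at most `k`. -/
def psdRank (N k : ℕ) (I : Set ℂ) : Set (Matrix (Fin N) (Fin N) ℂ) :=
  {A | A.PosSemidef ∧ A.rank ≤ k ∧ ∀ i j, A i j ∈ I}

/-- The set `𝒫_N(I) = 𝒫_N^N(I)` of positive semidefinite `N × N` matrices with entries in `I`. -/
def psd (N : ℕ) (I : Set ℂ) : Set (Matrix (Fin N) (Fin N) ℂ) :=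
  psdRank N N I

/-- The entrywise map `f[A] = (f(a_{jk}))`. -/
def entrywise {N : ℕ} (f : ℂ → ℂ) (A : Matrix (Fin N) (Fin N) ℂ) : Matrix (Fin N) (Fin N) ℂ :=
  A.map f

/-- The Hadamard (entrywise) power `A^{∘n}`; `A^{∘0}` is the all-ones matrix. -/
def hadamardPow {N : ℕ} (A : Matrix (Fin N) (Fin N) ℂ) (n : ℕ) : Matrix (Fin N) (Fin N) ℂ :=
  entrywise (fun z => z ^ n) A

/-- The polynomial `h_c(z) = ∑_{j < N} c_j z^j`. -/
noncomputable def hPoly {N : ℕ} (c : Fin N → ℝ) (z : ℂ) : ℂ :=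
  ∑ j : Fin N, (c j : ℂ) * z ^ (j : ℕ)

/-- `h_c[A] = c_0 1 + c_1 A + ⋯ + c_{N-1} A^{∘(N-1)}`. -/
theorem entrywise_hPoly {N : ℕ} (c : Fin N → ℝ) (A : Matrix (Fin N) (Fin N) ℂ) :
    entrywise (hPoly c) A = ∑ j : Fin N, (c j : ℂ) • hadamardPow A (j : ℕ) := by
  ext i k
  simp [entrywise, hPoly, hadamardPow, Matrix.sum_apply]

theorem hadamardPow_zero {N : ℕ} (A : Matrix (Fin N) (Fin N) ℂ) :
    hadamardPow A 0 = Matrix.of fun _ _ => 1 := by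
  ext i k
  simp [entrywise, hadamardPow]

/-- The kernel of a complex `N × N` matrix, as a subspace of the Hermitian space `ℂ^N`. -/
noncomputable def kernel {N : ℕ} (B : Matrix (Fin N) (Fin N) ℂ) :
    Submodule ℂ (EuclideanSpace ℂ (Fin N)) :=
  LinearMap.ker (Matrix.toEuclideanLin B)

/-- `𝒦(A) = ker h_c[A]`. -/
noncomputable def simKernel {N : ℕ} (c : Fin N → ℝ) (A : Matrix (Fin N) (Fin N) ℂ) :
    Submodule ℂ (EuclideanSpace ℂ (Fin N)) :=
  kernel (entrywise (hPoly c) A)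

/-- The value `u^* B u`, which is real for Hermitian `B`. -/
def quadForm {N : ℕ} (B : Matrix (Fin N) (Fin N) ℂ) (u : EuclideanSpace ℂ (Fin N)) : ℝ :=
  (star u.ofLp ⬝ᵥ (B.mulVec u.ofLp)).re

/-- `t` is the extreme critical value `𝒞(h; g; 𝒫)`: the smallest real number such that
`g[A] ≤ t · h[A]` in the Loewner order, for all `A ∈ 𝒫`. The existence of such a `t` is
the finiteness of `𝒞(h; g; 𝒫)`. -/
def IsExtremeCriticalValue {N : ℕ} (h g : ℂ → ℂ) (P : Set (Matrix (Fin N) (Fin N) ℂ))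
    (t : ℝ) : Prop :=
  IsLeast {s : ℝ | ∀ A ∈ P, ((s : ℂ) • entrywise h A - entrywise g A).PosSemidef} t

/-- The set of values of the Rayleigh quotient `u^* A^{∘M} u / u^* (∑_j c_j A^{∘j}) u` over
the nonzero vectors `u ∈ 𝒦(A)^⊥`. -/
noncomputable def rayleighValues {N : ℕ} (c : Fin N → ℝ) (M : ℕ)
    (A : Matrix (Fin N) (Fin N) ℂ) : Set ℝ :=
  {r | ∃ u ∈ (simKernel c A)ᗮ, u ≠ 0 ∧
    r = quadForm (hadamardPow A M) u /
      quadForm (∑ j : Fin N, (c j : ℂ) • hadamardPow A (j : ℕ)) u}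

/-- The constant
`𝒞(c; z^M; N, ρ) = ∑_{j < N} (M choose j)^2 (M-j-1 choose N-j-1)^2 ρ^{M-j} / c_j`.
It is used for `M ≥ N`, where none of the subtractions truncates. -/
noncomputable def threshold {N : ℕ} (c : Fin N → ℝ) (M : ℕ) (ρ : ℝ) : ℝ :=
  ∑ j : Fin N, (M.choose j : ℝ) ^ 2 * ((M - j - 1).choose (N - j - 1) : ℝ) ^ 2 *
    (ρ ^ (M - (j : ℕ)) / c j)

/-- The set of the extreme critical values `𝒞(h_c; z^M; A)` as `A` runs over `P`. -/
def criticalValues {N : ℕ} (c : Fin N → ℝ) (M : ℕ) (P : Set (Matrix (Fin N) (Fin N) ℂ)) :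
    Set ℝ :=
  {t | ∃ A ∈ P, IsExtremeCriticalValue (hPoly c) (fun z => z ^ M) {A} t}

end HadamardRayleigh

open scoped ComplexOrder

namespace HadamardRayleigh

open Matrix Filter Topology

/-! For `A = v v*` the form of `A^{∘n}` is `|S n|²`, where `S n` is a moment of the nodes `v i`.
Reducing `X ^ M` modulo `∏ (X - v i)` gives `S M = ∑ d j * S j` over `j < N`, and Cauchy–Schwarz
with weights `c j` bounds the Rayleigh quotient by `∑ |d j|² / c j`. The `d j` are polynomials in
the nodes, and for nodes of modulus at most `√ρ` each is largest in modulus when all nodes equal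
`√ρ`, where the sum is `threshold`.

A general `A` is handled by induction on `N`. Some `B = v v*` with `A - B` positive semidefinite
shares its first row and column with `A`. For `F = t * h_c - z ^ M`, monotonicity of `F` along the
segment from `B` to `A` follows once `F'` preserves positivity in size `N - 1`. This is the same
problem for shifted coefficients, whose threshold is no larger (`threshold_shift_le`).

For sharpness, distinct nodes have an invertible Vandermonde matrix, so equality in Cauchy–Schwarz
is attained. Letting the nodes tend to `√ρ` gives the threshold, by continuity of the `d j`. -/

/-- The complete homogeneous symmetric polynomial of degree `m` in `x, u 0, …, u (n - 1)`. -/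
def completeSym (u : ℕ → ℂ) (x : ℂ) : ℕ → ℕ → ℂ
  | 0, m => x ^ m
  | _ + 1, 0 => 1
  | n + 1, m + 1 => completeSym u x n (m + 1) + u n * completeSym u x (n + 1) m

/-- The coefficient of `X ^ j` in `∏ i < n, (X - u i)`. -/
def nodalCoeff (u : ℕ → ℂ) : ℕ → ℕ → ℂ
  | 0, 0 => 1
  | 0, _ + 1 => 0
  | n + 1, 0 => -(u n * nodalCoeff u n 0)
  | n + 1, j + 1 => nodalCoeff u n j - u n * nodalCoeff u n (j + 1)

/-- The coefficient of `X ^ j` in the remainder of `X ^ (n + m)` modulo `∏ i < n, (X - u i)`. -/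
def remCoeff (u : ℕ → ℂ) (m : ℕ) : ℕ → ℕ → ℂ
  | 0, _ => 0
  | n + 1, 0 => u n * completeSym u (u n) n m * nodalCoeff u n 0
  | n + 1, j + 1 =>
      remCoeff u m n j + u n * completeSym u (u n) n m * nodalCoeff u n (j + 1)

/-- The modulus of `remCoeff (fun _ => 1) m n j`. -/
def remBound (m : ℕ) : ℕ → ℕ → ℕ
  | 0, _ => 0
  | n + 1, 0 => (n + m).choose n
  | n + 1, j + 1 => remBound m n j + (n + m).choose n * n.choose (j + 1)

/-! ### Division of `X ^ (n + m)` by the nodal polynomial. -/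

theorem completeSym_zero_right (u : ℕ → ℂ) (x : ℂ) (n : ℕ) : completeSym u x n 0 = 1 := by
  cases n <;> simp [completeSym]

/-- Both sides are the degree `m + 1` symmetric polynomial in `u 0, …, u (n - 1)` alone: in
generating functions, the factor `1 - x T` removes the variable `x`. -/
theorem completeSym_succ_sub (u : ℕ → ℂ) (x y : ℂ) (n m : ℕ) :
    completeSym u x n (m + 1) - x * completeSym u x n m =
      completeSym u y n (m + 1) - y * completeSym u y n m := by
  induction n generalizing m with
  | zero => simp [completeSym, pow_succ']
  | succ n ih =>
    induction m with
    | zero =>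
      have := ih 0
      simp only [completeSym, completeSym_zero_right] at this ⊢
      linear_combination this
    | succ m ihm =>
      have := ih (m + 1)
      rw [completeSym, completeSym.eq_3 u y, completeSym.eq_3 u x n m, completeSym.eq_3 u y n m]
      rw [completeSym, completeSym.eq_3 u y] at ihm
      linear_combination this + u n * ihm

/-- Divides `x` times the old quotient by `x - u n`; the constant left over is the new contribution
in the recursion for `remCoeff`. -/
theorem completeSym_succ_mul (u : ℕ → ℂ) (x : ℂ) (n m : ℕ) :
    u n * completeSym u (u n) n m + (x - u n) * completeSym u x (n + 1) m =
      x * completeSym u x n m := by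
  induction m with
  | zero => simp [completeSym_zero_right]
  | succ m ih =>
    rw [completeSym]
    linear_combination u n * ih - u n * completeSym_succ_sub u x (u n) n m

theorem nodalCoeff_eq_zero (u : ℕ → ℂ) {n j : ℕ} (h : n < j) : nodalCoeff u n j = 0 := by
  induction n generalizing j with
  | zero => obtain ⟨j, rfl⟩ := Nat.exists_eq_succ_of_ne_zero h.ne'; rfl
  | succ n ih =>
    obtain ⟨j, rfl⟩ := Nat.exists_eq_succ_of_ne_zero (Nat.ne_zero_of_lt h)
    rw [Nat.succ_eq_add_one, nodalCoeff, ih (by lia), ih (by lia)]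
    simp

theorem sum_nodalCoeff_mul_pow (u : ℕ → ℂ) (x : ℂ) (n : ℕ) :
    ∑ j ∈ Finset.range (n + 1), nodalCoeff u n j * x ^ j = ∏ i ∈ Finset.range n, (x - u i) := by
  induction n with
  | zero => simp [nodalCoeff]
  | succ n ih =>
    have h : ∑ j ∈ Finset.range (n + 2), nodalCoeff u n j * x ^ j =
        ∏ i ∈ Finset.range n, (x - u i) := by
      rw [Finset.sum_range_succ, ih, nodalCoeff_eq_zero u (Nat.lt_succ_self n)]
      simp
    rw [Finset.prod_range_succ, Finset.sum_range_succ']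
    rw [Finset.sum_range_succ'] at h
    have e : ∀ j ∈ Finset.range (n + 1), nodalCoeff u (n + 1) (j + 1) * x ^ (j + 1) =
        x * (nodalCoeff u n j * x ^ j) - u n * (nodalCoeff u n (j + 1) * x ^ (j + 1)) := by
      intro j _
      rw [nodalCoeff]
      ring
    rw [Finset.sum_congr rfl e, Finset.sum_sub_distrib, ← Finset.mul_sum, ← Finset.mul_sum, ih,
      nodalCoeff]
    linear_combination -u n * h

theorem sum_remCoeff_mul_pow_add (u : ℕ → ℂ) (x : ℂ) (n m : ℕ) :
    ∑ j ∈ Finset.range n, remCoeff u m n j * x ^ j +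
      completeSym u x n m * ∏ i ∈ Finset.range n, (x - u i) = x ^ (n + m) := by
  induction n with
  | zero => simp [completeSym]
  | succ n ih =>
    have h := sum_nodalCoeff_mul_pow u x n
    rw [Finset.sum_range_succ'] at h
    rw [Finset.prod_range_succ, Finset.sum_range_succ']
    have e : ∀ j ∈ Finset.range n, remCoeff u m (n + 1) (j + 1) * x ^ (j + 1) =
        x * (remCoeff u m n j * x ^ j) +
          u n * completeSym u (u n) n m * (nodalCoeff u n (j + 1) * x ^ (j + 1)) := by
      intro j _
      rw [remCoeff]
      ring
    rw [Finset.sum_congr rfl e, Finset.sum_add_distrib, ← Finset.mul_sum, ← Finset.mul_sum,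
      remCoeff, show n + 1 + m = n + m + 1 by ring, pow_succ']
    linear_combination x * ih + u n * completeSym u (u n) n m * h +
      (∏ i ∈ Finset.range n, (x - u i)) * completeSym_succ_mul u x n m

theorem sum_remCoeff_mul_pow (u : ℕ → ℂ) (n m : ℕ) {i : ℕ} (hi : i < n) :
    ∑ j ∈ Finset.range n, remCoeff u m n j * u i ^ j = u i ^ (n + m) := by
  rw [← sum_remCoeff_mul_pow_add u (u i) n m,
    Finset.prod_eq_zero (Finset.mem_range.2 hi) (sub_self _)]
  simp

/-! ### Coefficient bounds, with equality at equal nodes. -/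

/-- There are `(n + m).choose n` monomials of degree `m` in `n + 1` variables. -/
theorem norm_completeSym_le {u : ℕ → ℂ} {x : ℂ} {r : ℝ} (hr : 0 ≤ r) (hu : ∀ i, ‖u i‖ ≤ r)
    (hx : ‖x‖ ≤ r) (n m : ℕ) : ‖completeSym u x n m‖ ≤ (n + m).choose n * r ^ m := by
  induction n generalizing m with
  | zero => simpa [completeSym] using pow_le_pow_left₀ (norm_nonneg x) hx m
  | succ n ih =>
    induction m with
    | zero => simp [completeSym]
    | succ m ihm =>
      rw [completeSym]
      calc _ ≤ ‖completeSym u x n (m + 1)‖ + ‖u n‖ * ‖completeSym u x (n + 1) m‖ := by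
            rw [← norm_mul]; exact norm_add_le _ _
        _ ≤ (n + (m + 1)).choose n * r ^ (m + 1) + r * ((n + 1 + m).choose (n + 1) * r ^ m) := by
            gcongr
            · exact ih _
            · exact hu n
        _ = _ := by
            rw [show n + 1 + (m + 1) = (n + (m + 1)) + 1 by ring, Nat.choose_succ_succ,
              show n + 1 + m = n + (m + 1) by ring]
            push_cast
            ring

theorem completeSym_const (r : ℂ) (n m : ℕ) :
    completeSym (fun _ => r) r n m = (n + m).choose n * r ^ m := by
  induction n generalizing m with
  | zero => simp [completeSym]
  | succ n ih =>
    induction m with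
    | zero => simp [completeSym]
    | succ m ihm =>
      rw [completeSym, ihm, ih, show n + 1 + (m + 1) = (n + (m + 1)) + 1 by ring,
        Nat.choose_succ_succ, show n + 1 + m = n + (m + 1) by ring]
      push_cast
      ring

theorem norm_nodalCoeff_mul_le {u : ℕ → ℂ} {r : ℝ} (hr : 0 ≤ r) (hu : ∀ i, ‖u i‖ ≤ r) (n j : ℕ) :
    ‖nodalCoeff u n j‖ * r ^ j ≤ n.choose j * r ^ n := by
  induction n generalizing j with
  | zero => cases j <;> simp [nodalCoeff]
  | succ n ih =>
    cases j with
    | zero =>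
      have := ih 0
      simp only [nodalCoeff, norm_neg, norm_mul, Nat.choose_zero_right, pow_zero, mul_one,
        Nat.cast_one, one_mul] at this ⊢
      rw [pow_succ']
      exact mul_le_mul (hu n) this (norm_nonneg _) hr
    | succ j =>
      rw [nodalCoeff]
      calc _ ≤ (‖nodalCoeff u n j‖ + ‖u n‖ * ‖nodalCoeff u n (j + 1)‖) * r ^ (j + 1) := by
            rw [← norm_mul]; gcongr; exact norm_sub_le _ _
        _ = r * (‖nodalCoeff u n j‖ * r ^ j) + ‖u n‖ * (‖nodalCoeff u n (j + 1)‖ * r ^ (j + 1)) := by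
            ring
        _ ≤ r * (n.choose j * r ^ n) + r * (n.choose (j + 1) * r ^ n) := by
            exact add_le_add (mul_le_mul_of_nonneg_left (ih j) hr)
              (mul_le_mul (hu n) (ih (j + 1)) (by positivity) hr)
        _ = _ := by
            rw [Nat.choose_succ_succ]
            push_cast
            ring

theorem nodalCoeff_const_mul (r : ℂ) (n j : ℕ) :
    nodalCoeff (fun _ => r) n j * r ^ j = (-1) ^ (n + j) * n.choose j * r ^ n := by
  induction n generalizing j with
  | zero => cases j <;> simp [nodalCoeff]
  | succ n ih =>
    cases j with
    | zero =>
      have := ih 0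
      simp only [nodalCoeff, Nat.choose_zero_right, pow_zero, mul_one, Nat.cast_one,
        add_zero] at this ⊢
      rw [this]
      ring
    | succ j =>
      have h0 := ih j
      have h1 := ih (j + 1)
      rw [nodalCoeff, Nat.choose_succ_succ]
      push_cast
      rw [show n + 1 + (j + 1) = (n + j) + 2 by ring]
      rw [show n + (j + 1) = (n + j) + 1 by ring] at h1
      linear_combination r * h0 - r * h1

theorem norm_remCoeff_mul_le {u : ℕ → ℂ} {r : ℝ} (hr : 0 ≤ r) (hu : ∀ i, ‖u i‖ ≤ r) (m n j : ℕ) :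
    ‖remCoeff u m n j‖ * r ^ j ≤ remBound m n j * r ^ (n + m) := by
  have key (n j : ℕ) : ‖u n * completeSym u (u n) n m * nodalCoeff u n j‖ * r ^ j ≤
      ((n + m).choose n * n.choose j) * r ^ (n + 1 + m) := by
    rw [norm_mul, norm_mul]
    calc _ = ‖u n‖ * ‖completeSym u (u n) n m‖ * (‖nodalCoeff u n j‖ * r ^ j) := by ring
      _ ≤ r * ((n + m).choose n * r ^ m) * (n.choose j * r ^ n) := by
          exact mul_le_mul (mul_le_mul (hu n) (norm_completeSym_le hr hu (hu n) n m)
            (norm_nonneg _) hr) (norm_nodalCoeff_mul_le hr hu n j) (by positivity) (by positivity)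
      _ = _ := by ring
  induction n generalizing j with
  | zero => simp [remCoeff, remBound]
  | succ n ih =>
    cases j with
    | zero => simpa [remCoeff, remBound] using key n 0
    | succ j =>
      rw [remCoeff, remBound]
      calc _ ≤ (‖remCoeff u m n j‖ +
            ‖u n * completeSym u (u n) n m * nodalCoeff u n (j + 1)‖) * r ^ (j + 1) := by
            gcongr; exact norm_add_le _ _
        _ = r * (‖remCoeff u m n j‖ * r ^ j) +
            ‖u n * completeSym u (u n) n m * nodalCoeff u n (j + 1)‖ * r ^ (j + 1) := by ring
        _ ≤ r * (remBound m n j * r ^ (n + m)) +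
            ((n + m).choose n * n.choose (j + 1)) * r ^ (n + 1 + m) := by
            exact add_le_add (mul_le_mul_of_nonneg_left (ih j) hr) (key n (j + 1))
        _ = _ := by
            push_cast
            ring

/-- At equal nodes both summands of the recursion carry the sign `(-1) ^ (n + 1 + j)`, so nothing
cancels and the preceding triangle inequality is sharp. -/
theorem remCoeff_const_mul (r : ℂ) (m n j : ℕ) :
    remCoeff (fun _ => r) m n j * r ^ j = (-1) ^ (n + 1 + j) * remBound m n j * r ^ (n + m) := by
  induction n generalizing j with
  | zero => simp [remCoeff, remBound]
  | succ n ih =>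
    have key := nodalCoeff_const_mul r n j
    cases j with
    | zero =>
      simp only [remCoeff, remBound, completeSym_const] at key ⊢
      simp only [Nat.choose_zero_right, Nat.cast_one] at key
      rw [show n + 1 + 1 + 0 = n + 0 + 2 by ring]
      linear_combination r * ((n + m).choose n * r ^ m) * key
    | succ j =>
      have h0 := ih j
      simp only [remCoeff, remBound, completeSym_const]
      push_cast
      rw [show n + 1 + 1 + (j + 1) = n + j + 3 by ring]
      rw [show n + 1 + j = n + j + 1 by ring] at h0
      rw [show n + (j + 1) = n + j + 1 by ring] at key
      linear_combination r * h0 + r * ((n + m).choose n * r ^ m) * key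

/-- The recursion lowers `n` and `j` together, so `k = n - j - 1` stays fixed; trinomial revision
and Pascal's rule give the step. -/
theorem remBound_eq (m k j : ℕ) :
    remBound m (j + 1 + k) j = (j + 1 + k + m).choose j * (k + m).choose k := by
  induction j with
  | zero =>
    rw [show 0 + 1 + k = k + 1 by ring, remBound]
    simp
  | succ j ih =>
    have h := Nat.choose_mul (n := j + 1 + k + m) (k := j + 1 + k) (s := j + 1) (by lia)
    rw [show j + 1 + k + m - (j + 1) = k + m by lia, show j + 1 + k - (j + 1) = k by lia] at h
    rw [show j + 1 + 1 + k = j + 1 + k + 1 by ring, remBound, ih, h,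
      show j + 1 + k + 1 + m = j + 1 + k + m + 1 by ring, Nat.choose_succ_succ]
    ring

/-! ### Continuity in the nodes, including where they collide. -/

theorem continuous_completeSym {u : ℝ → ℕ → ℂ} (hu : ∀ i, Continuous fun s => u s i) {x : ℝ → ℂ}
    (hx : Continuous x) (n m : ℕ) : Continuous fun s => completeSym (u s) (x s) n m := by
  induction n generalizing m with
  | zero => simp only [completeSym]; fun_prop
  | succ n ih =>
    induction m with
    | zero => simpa only [completeSym] using continuous_const
    | succ m ihm => simp only [completeSym]; fun_prop

theorem continuous_nodalCoeff {u : ℝ → ℕ → ℂ} (hu : ∀ i, Continuous fun s => u s i) (n j : ℕ) :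
    Continuous fun s => nodalCoeff (u s) n j := by
  induction n generalizing j with
  | zero => cases j <;> simpa only [nodalCoeff] using continuous_const
  | succ n ih =>
    cases j with
    | zero => simp only [nodalCoeff]; fun_prop
    | succ j => simp only [nodalCoeff]; fun_prop

theorem continuous_remCoeff {u : ℝ → ℕ → ℂ} (hu : ∀ i, Continuous fun s => u s i) (m n j : ℕ) :
    Continuous fun s => remCoeff (u s) m n j := by
  induction n generalizing j with
  | zero => simpa only [remCoeff] using continuous_const
  | succ n ih =>
    have hc := continuous_completeSym hu (hu n) n m
    have hd := continuous_nodalCoeff hu n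
    cases j with
    | zero => simp only [remCoeff]; fun_prop
    | succ j => simp only [remCoeff]; fun_prop

/-! ### Quadratic forms and Hadamard powers. -/

section

variable {N : ℕ}

theorem quadForm_eq_sum (B : Matrix (Fin N) (Fin N) ℂ) (u : EuclideanSpace ℂ (Fin N)) :
    quadForm B u = (∑ i, ∑ j, star (u i) * B i j * u j).re := by
  simp [quadForm, dotProduct, mulVec, Finset.mul_sum, mul_assoc]

theorem quadForm_sub (A B : Matrix (Fin N) (Fin N) ℂ) (u : EuclideanSpace ℂ (Fin N)) :
    quadForm (A - B) u = quadForm A u - quadForm B u := by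
  simp [quadForm, sub_mulVec, dotProduct_sub]

theorem quadForm_smul (s : ℝ) (A : Matrix (Fin N) (Fin N) ℂ) (u : EuclideanSpace ℂ (Fin N)) :
    quadForm ((s : ℂ) • A) u = s * quadForm A u := by
  simp [quadForm, smul_mulVec, dotProduct_smul]

theorem quadForm_sum {ι : Type*} (s : Finset ι) (A : ι → Matrix (Fin N) (Fin N) ℂ)
    (u : EuclideanSpace ℂ (Fin N)) :
    quadForm (∑ i ∈ s, A i) u = ∑ i ∈ s, quadForm (A i) u := by
  simp [quadForm, sum_mulVec, dotProduct_sum]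

theorem quadForm_hPoly (c : Fin N → ℝ) (A : Matrix (Fin N) (Fin N) ℂ)
    (u : EuclideanSpace ℂ (Fin N)) :
    quadForm (entrywise (hPoly c) A) u = ∑ j, c j * quadForm (hadamardPow A j) u := by
  simp only [entrywise_hPoly, quadForm_sum, quadForm_smul]

theorem posSemidef_iff_quadForm {B : Matrix (Fin N) (Fin N) ℂ} (hB : B.IsHermitian) :
    B.PosSemidef ↔ ∀ u, 0 ≤ quadForm B u := by
  rw [posSemidef_iff_dotProduct_mulVec]
  refine ⟨fun h u => (Complex.nonneg_iff.1 (h.2 u.ofLp)).1, fun h => ⟨hB, fun x => ?_⟩⟩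
  exact Complex.nonneg_iff.2
    ⟨h (WithLp.toLp 2 x), (hB.im_star_dotProduct_mulVec_self x).symm⟩

theorem quadForm_nonneg {B : Matrix (Fin N) (Fin N) ℂ} (hB : B.PosSemidef)
    (u : EuclideanSpace ℂ (Fin N)) : 0 ≤ quadForm B u :=
  (posSemidef_iff_quadForm hB.1).1 hB u

theorem quadForm_eq_zero_iff {B : Matrix (Fin N) (Fin N) ℂ} (hB : B.PosSemidef)
    (u : EuclideanSpace ℂ (Fin N)) : quadForm B u = 0 ↔ u ∈ kernel B := by
  have h1 : u ∈ kernel B ↔ B *ᵥ u.ofLp = 0 := by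
    simp [kernel, LinearMap.mem_ker, Matrix.toLpLin_apply]
  rw [h1, ← hB.dotProduct_mulVec_zero_iff, quadForm, Complex.ext_iff]
  have h2 := hB.1.im_star_dotProduct_mulVec_self u.ofLp
  exact ⟨fun h => ⟨h, h2⟩, fun h => h.1⟩

theorem hadamardPow_posSemidef {A : Matrix (Fin N) (Fin N) ℂ} (hA : A.PosSemidef) (n : ℕ) :
    (hadamardPow A n).PosSemidef := by
  induction n with
  | zero =>
    convert posSemidef_vecMulVec_self_star (fun _ : Fin N => (1 : ℂ)) using 1
    ext i j
    simp [hadamardPow, entrywise, vecMulVec]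
  | succ n ih =>
    have h : hadamardPow A (n + 1) = hadamardPow A n ⊙ A := by
      ext i j
      simp [hadamardPow, entrywise, pow_succ]
    rw [h]
    exact ih.hadamard hA

theorem hPoly_posSemidef {c : Fin N → ℝ} (hc : ∀ j, 0 < c j) {A : Matrix (Fin N) (Fin N) ℂ}
    (hA : A.PosSemidef) : (entrywise (hPoly c) A).PosSemidef := by
  rw [entrywise_hPoly]
  refine posSemidef_sum _ fun j _ => ?_
  exact (hadamardPow_posSemidef hA j).smul (by exact_mod_cast (hc j).le)

theorem posSemidef_sub_iff {c : Fin N → ℝ} (hc : ∀ j, 0 < c j) {A : Matrix (Fin N) (Fin N) ℂ}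
    (hA : A.PosSemidef) (s : ℝ) (M : ℕ) :
    ((s : ℂ) • entrywise (hPoly c) A - entrywise (fun z => z ^ M) A).PosSemidef ↔
      ∀ u, quadForm (hadamardPow A M) u ≤ s * quadForm (entrywise (hPoly c) A) u := by
  have hB : ((s : ℂ) • entrywise (hPoly c) A - entrywise (fun z => z ^ M) A).IsHermitian := by
    refine IsHermitian.sub ?_ (hadamardPow_posSemidef hA M).1
    rw [IsHermitian, conjTranspose_smul, (hPoly_posSemidef hc hA).1.eq]
    simp
  rw [posSemidef_iff_quadForm hB]
  simp only [quadForm_sub, quadForm_smul, sub_nonneg]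
  rfl

/-! ### Rank-one matrices. -/

theorem quadForm_hadamardPow_vecMulVec (v : Fin N → ℂ) (n : ℕ) (u : EuclideanSpace ℂ (Fin N)) :
    quadForm (hadamardPow (vecMulVec v (star v)) n) u = ‖∑ i, star (u i) * v i ^ n‖ ^ 2 := by
  rw [quadForm_eq_sum, ← Complex.ofReal_re (‖_‖ ^ 2)]
  congr 1
  push_cast
  rw [← Complex.mul_conj', map_sum, Finset.sum_mul_sum]
  refine Finset.sum_congr rfl fun i _ => Finset.sum_congr rfl fun j _ => ?_
  simp [hadamardPow, entrywise, vecMulVec, mul_pow]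
  ring

/-- The value `∑ j, |d j|² / c j`, where `d` are the coefficients of the remainder of `X ^ (N + m)`
modulo `∏ i < N, (X - u i)`. -/
noncomputable def remWeight (c : Fin N → ℝ) (m : ℕ) (u : ℕ → ℂ) : ℝ :=
  ∑ j : Fin N, ‖remCoeff u m N j‖ ^ 2 / c j

theorem remBound_eq_choose_mul_choose (m : ℕ) (j : Fin N) :
    remBound m N j = (N + m).choose j * (N + m - j - 1).choose (N - j - 1) := by
  obtain ⟨k, hk⟩ := Nat.exists_eq_add_of_lt j.2
  have h := remBound_eq m k j
  rw [show (j : ℕ) + 1 + k = N by lia] at h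
  rw [h, show N + m - j - 1 = k + m by lia, show N - (j : ℕ) - 1 = k by lia]

theorem threshold_term (m : ℕ) (j : Fin N) {ρ : ℝ} (hρ : 0 < ρ) (c : ℝ) :
    ((N + m).choose j : ℝ) ^ 2 * ((N + m - j - 1).choose (N - j - 1) : ℝ) ^ 2 *
      (ρ ^ (N + m - (j : ℕ)) / c) = (remBound m N j * √ρ ^ (N + m - (j : ℕ))) ^ 2 / c := by
  rw [remBound_eq_choose_mul_choose, mul_pow, ← pow_mul, mul_comm _ 2, pow_mul,
    Real.sq_sqrt hρ.le]
  push_cast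
  ring

theorem remWeight_le_threshold {c : Fin N → ℝ} (hc : ∀ j, 0 < c j) (m : ℕ) {ρ : ℝ} (hρ : 0 < ρ)
    {u : ℕ → ℂ} (hu : ∀ i, ‖u i‖ ≤ √ρ) : remWeight c m u ≤ threshold c (N + m) ρ := by
  refine Finset.sum_le_sum fun j _ => ?_
  have hr := Real.sqrt_pos.2 hρ
  rw [threshold_term m j hρ]
  have h := norm_remCoeff_mul_le hr.le hu m N j
  rw [← Nat.sub_add_cancel (show (j : ℕ) ≤ N + m by lia), pow_add, ← mul_assoc] at h
  have h' := le_of_mul_le_mul_right h (pow_pos hr _)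
  have := hc j
  gcongr

theorem remWeight_const (c : Fin N → ℝ) (m : ℕ) {ρ : ℝ} (hρ : 0 < ρ) :
    remWeight c m (fun _ => (√ρ : ℂ)) = threshold c (N + m) ρ := by
  refine Finset.sum_congr rfl fun j _ => ?_
  have hr := Real.sqrt_pos.2 hρ
  rw [threshold_term m j hρ]
  have h := congrArg norm (remCoeff_const_mul (√ρ : ℂ) m N j)
  rw [← Nat.sub_add_cancel (show (j : ℕ) ≤ N + m by lia), pow_add (√ρ : ℂ), ← mul_assoc,
    norm_mul, norm_mul _ ((√ρ : ℂ) ^ (j : ℕ))] at h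
  have h' := mul_right_cancel₀ 
    (norm_ne_zero_iff.2 (pow_ne_zero _ (by exact_mod_cast hr.ne'))) h
  rw [h']
  simp [abs_of_pos hr]

/-- `X ^ (N + m)` and its remainder agree at every node, hence under any functional supported on the
nodes, which need not be distinct. -/
theorem sum_mul_pow_add (w : ℕ → ℂ) (m : ℕ) (x : Fin N → ℂ) :
    ∑ i, x i * w i ^ (N + m) =
      ∑ j : Fin N, remCoeff w m N j * ∑ i, x i * w i ^ (j : ℕ) := by
  simp only [Finset.mul_sum]
  rw [Finset.sum_comm]
  refine Finset.sum_congr rfl fun i _ => ?_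
  rw [← sum_remCoeff_mul_pow w N m i.2, ← Fin.sum_univ_eq_sum_range
    (fun j => remCoeff w m N j * w i ^ j), Finset.mul_sum]
  exact Finset.sum_congr rfl fun j _ => by ring

theorem quadForm_vecMulVec_le {c : Fin N → ℝ} (hc : ∀ j, 0 < c j) (m : ℕ) {ρ : ℝ} (hρ : 0 < ρ)
    {v : Fin N → ℂ} (hv : ∀ i, ‖v i‖ ≤ √ρ) (u : EuclideanSpace ℂ (Fin N)) :
    quadForm (hadamardPow (vecMulVec v (star v)) (N + m)) u ≤
      threshold c (N + m) ρ * quadForm (entrywise (hPoly c) (vecMulVec v (star v))) u := by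
  -- Padding by zero keeps the norm bound for all indices; only the first `N` nodes matter.
  set w : ℕ → ℂ := fun i => if h : i < N then v ⟨i, h⟩ else 0 with hw
  have hwv (i : Fin N) : w i = v i := by simp [hw]
  have hwr (i : ℕ) : ‖w i‖ ≤ √ρ := by
    by_cases h : i < N
    · simpa [hw, h] using hv ⟨i, h⟩
    · simp [hw, h]
  simp only [quadForm_hPoly, quadForm_hadamardPow_vecMulVec]
  set S : Fin N → ℂ := fun j => ∑ i, star (u i) * v i ^ (j : ℕ)
  have hS : ∑ i, star (u i) * v i ^ (N + m) = ∑ j : Fin N, remCoeff w m N j * S j := by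
    simpa only [hwv] using sum_mul_pow_add w m fun i => star (u i)
  have hE : 0 ≤ ∑ j, c j * ‖S j‖ ^ 2 :=
    Finset.sum_nonneg fun j _ => mul_nonneg (hc j).le (sq_nonneg _)
  calc _ ≤ (∑ j : Fin N, ‖remCoeff w m N j‖ * ‖S j‖) ^ 2 := by
        rw [hS]
        gcongr
        exact (norm_sum_le _ _).trans_eq (Finset.sum_congr rfl fun j _ => norm_mul _ _)
    _ ≤ remWeight c m w * ∑ j, c j * ‖S j‖ ^ 2 := by
        refine Finset.sum_sq_le_sum_mul_sum_of_sq_le_mul _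
          (fun j _ => div_nonneg (sq_nonneg _) (hc j).le)
          (fun j _ => mul_nonneg (hc j).le (sq_nonneg _)) fun j _ => le_of_eq ?_
        have := (hc j).ne'
        field_simp
    _ ≤ _ := mul_le_mul_of_nonneg_right (remWeight_le_threshold hc m hρ hwr) hE

end

/-! ### From rank one to all positive semidefinite matrices. -/

theorem hasDerivAt_quadForm_entrywise {N : ℕ} {F F' : ℂ → ℂ} (hF : ∀ z, HasDerivAt F (F' z) z)
    (B D : Matrix (Fin N) (Fin N) ℂ) (u : EuclideanSpace ℂ (Fin N)) (x : ℝ) :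
    HasDerivAt (fun y : ℝ => quadForm (entrywise F (B + (y : ℂ) • D)) u)
      (quadForm (entrywise F' (B + (x : ℂ) • D) ⊙ D) u) x := by
  simp only [quadForm_eq_sum]
  refine Complex.reCLM.hasFDerivAt.comp_hasDerivAt x ?_
  refine HasDerivAt.fun_sum fun i _ => HasDerivAt.fun_sum fun j _ => ?_
  refine (HasDerivAt.const_mul _ ?_).mul_const _
  have h1 : HasDerivAt (fun z : ℂ => B i j + z * D i j) (D i j) (x : ℂ) := by
    simpa using ((hasDerivAt_id (x : ℂ)).mul_const (D i j)).const_add (B i j)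
  exact ((hF _).comp (x : ℂ) h1).comp_ofReal

/-- If `A ≥ B` agree on the first row and column and `F'` maps the segment from `B` to `A`, with
the first row and column removed, to positive semidefinite matrices, then `F[B] ≤ F[A]`. -/
theorem quadForm_entrywise_le {N : ℕ} {F F' : ℂ → ℂ} (hF : ∀ z, HasDerivAt F (F' z) z)
    {A B : Matrix (Fin (N + 1)) (Fin (N + 1)) ℂ} (hD : (A - B).PosSemidef)
    (hrow : ∀ j, A 0 j = B 0 j) (hcol : ∀ i, A i 0 = B i 0)
    (h : ∀ x ∈ Set.Icc (0 : ℝ) 1,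
      (entrywise F' ((B + (x : ℂ) • (A - B)).submatrix Fin.succ Fin.succ)).PosSemidef)
    (u : EuclideanSpace ℂ (Fin (N + 1))) :
    quadForm (entrywise F B) u ≤ quadForm (entrywise F A) u := by
  have hd := hasDerivAt_quadForm_entrywise hF B (A - B) u
  have hm : MonotoneOn (fun y : ℝ => quadForm (entrywise F (B + (y : ℂ) • (A - B))) u)
      (Set.Icc 0 1) := by
    refine monotoneOn_of_deriv_nonneg (convex_Icc 0 1)
      (fun x _ => (hd x).continuousAt.continuousWithinAt)
      (fun x _ => (hd x).differentiableAt.differentiableWithinAt) fun x hx => ?_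
    rw [(hd x).deriv]
    -- The derivative is the form of a Schur product with `A - B`, whose first row and column
    -- vanish, so only the trailing block contributes.
    have hP := (h x (interior_subset hx)).hadamard (hD.submatrix Fin.succ)
    convert quadForm_nonneg hP (WithLp.toLp 2 fun i => u i.succ) using 1
    rw [quadForm_eq_sum, quadForm_eq_sum]
    simp [Fin.sum_univ_succ, hrow, hcol, entrywise]
  have := hm (Set.left_mem_Icc.2 zero_le_one) (Set.right_mem_Icc.2 zero_le_one) zero_le_one
  simpa using this

/-- Take `v` to be the first column divided by `√(A 0 0)`; then `A - v v*` is the Schur complement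
of the corner entry, bordered by zeros. -/
theorem exists_vecMulVec_le {N : ℕ} {A : Matrix (Fin (N + 1)) (Fin (N + 1)) ℂ}
    (hA : A.PosSemidef) : ∃ v : Fin (N + 1) → ℂ, (A - vecMulVec v (star v)).PosSemidef ∧
      (∀ j, A 0 j = vecMulVec v (star v) 0 j) ∧ ∀ i, A i 0 = vecMulVec v (star v) i 0 := by
  have hH (i j) : star (A i j) = A j i := hA.1.apply j i
  have ha : 0 ≤ A 0 0 := hA.diag_nonneg
  obtain ⟨a, ha0, hAa⟩ : ∃ a : ℝ, 0 ≤ a ∧ A 0 0 = a :=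
    ⟨(A 0 0).re, (Complex.nonneg_iff.1 ha).1, Complex.ext rfl (Complex.nonneg_iff.1 ha).2.symm⟩
  rcases ha0.eq_or_lt with rfl | hpos
  -- A zero diagonal entry forces a zero column, so `v = 0` works.
  · have h0 : A *ᵥ Pi.single 0 1 = 0 := by
      rw [← hA.dotProduct_mulVec_zero_iff]
      simp [hAa]
    have hc (i) : A i 0 = 0 := by simpa using congrFun h0 i
    refine ⟨0, by simpa using hA, fun j => ?_, fun i => by simp [hc]⟩
    rw [← hH, hc]
    simp
  have hane : (a : ℂ) ≠ 0 := by exact_mod_cast hpos.ne'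
  have hsq : (√a : ℂ) * √a = a := by exact_mod_cast Real.mul_self_sqrt ha0
  have hW (i j) : vecMulVec (fun i => A i 0 / (√a : ℂ)) (star fun i => A i 0 / (√a : ℂ)) i j =
      A i 0 * A 0 j / a := by
    have := hH j 0
    simp only [vecMulVec_apply, Pi.star_apply, star_div₀, this]
    rw [div_mul_div_comm, Complex.star_def, Complex.conj_ofReal, hsq]
  refine ⟨fun i => A i 0 / (√a : ℂ), ?_, fun j => ?_, fun i => ?_⟩
  -- Congruence by `1 - R` is the elimination step that clears the first row and column.
  · set R : Matrix (Fin (N + 1)) (Fin (N + 1)) ℂ := of fun k j => if k = 0 then A 0 j / a else 0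
    convert hA.conjTranspose_mul_mul_same (1 - R) using 1
    have h1 (i j) : (A * R) i j = A i 0 * A 0 j / a := by
      simp [R, mul_apply, mul_div_assoc]
    have h2 (X : Matrix (Fin (N + 1)) (Fin (N + 1)) ℂ) (i j) :
        (Rᴴ * X) i j = A i 0 / a * X 0 j := by
      have := hH 0 i
      simp only [Complex.star_def] at this
      simp [R, mul_apply, apply_ite, this]
    have h3 : (1 - R)ᴴ * A * (1 - R) = A - A * R - (Rᴴ * A - Rᴴ * (A * R)) := by
      rw [conjTranspose_sub, conjTranspose_one]
      noncomm_ring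
    rw [h3]
    ext i j
    simp only [Matrix.sub_apply, h1, h2, hW, hAa]
    field_simp
    ring
  · rw [hW, hAa]
    field_simp
  · rw [hW, hAa]
    field_simp

/-- Drop the term `j = 0` and match `j` with `j + 1`. Only the first binomials and the weights
change, and `(N + m + 1) / (j + 1)` times `(N + m).choose j` is `(N + m + 1).choose (j + 1)`. -/
theorem threshold_shift_le {N : ℕ} {c : Fin (N + 1) → ℝ} (hc : ∀ j, 0 < c j) (m : ℕ) {ρ : ℝ}
    (hρ : 0 < ρ) :
    threshold (fun j : Fin N => ((j : ℕ) + 1) * c j.succ / (N + 1 + m : ℕ)) (N + m) ρ ≤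
      threshold c (N + 1 + m) ρ := by
  rw [threshold, threshold, Fin.sum_univ_succ]
  refine le_add_of_nonneg_of_le (by have := hc 0; positivity)
    (Finset.sum_le_sum fun j _ => ?_)
  have hcj := hc j.succ
  rw [Fin.val_succ, show N + 1 + m - (j + 1) = N + m - j by lia,
    show N + 1 - (j + 1 : ℕ) = N - j by lia, show N + 1 + m = N + m + 1 by ring]
  have h1 : ((N + m + 1 : ℕ) : ℝ) * (N + m).choose j = (N + m + 1).choose (j + 1) * (j + 1) := by
    exact_mod_cast Nat.add_one_mul_choose_eq (N + m) j
  have h2 : ((N + m).choose j : ℝ) ≤ (N + m + 1).choose (j + 1) := by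
    exact_mod_cast Nat.choose_succ_succ (N + m) j ▸ Nat.le_add_right _ _
  set x : ℝ := (((N + m).choose j : ℕ) : ℝ)
  set y : ℝ := (((N + m + 1).choose (j + 1) : ℕ) : ℝ)
  set M : ℝ := ((N + m + 1 : ℕ) : ℝ)
  have hx : 0 ≤ x := Nat.cast_nonneg _
  have hj : (0 : ℝ) < (j : ℕ) + 1 := by positivity
  have h3 : x ^ 2 * (M / (j + 1)) ≤ y ^ 2 := by
    calc x ^ 2 * (M / (j + 1)) = x * (M * x) / (j + 1) := by ring
      _ = x * y := by rw [h1]; field_simp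
      _ ≤ y ^ 2 := by nlinarith
  calc _ = x ^ 2 * (M / (j + 1)) * (((N + m - j - 1).choose (N - j - 1) : ℝ) ^ 2 *
        (ρ ^ (N + m - (j : ℕ)) / c j.succ)) := by
        field_simp
    _ ≤ y ^ 2 * (((N + m - j - 1).choose (N - j - 1) : ℝ) ^ 2 *
        (ρ ^ (N + m - (j : ℕ)) / c j.succ)) := by gcongr
    _ = _ := by ring

/-- The extreme critical value of the monomial `z ^ (N + m)` is at most `threshold`. -/
theorem quadForm_hadamardPow_le {N : ℕ} {c : Fin N → ℝ} (hc : ∀ j, 0 < c j) (m : ℕ) {ρ t : ℝ}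
    (hρ : 0 < ρ) (ht : threshold c (N + m) ρ ≤ t) {A : Matrix (Fin N) (Fin N) ℂ}
    (hA : A.PosSemidef) (hAρ : ∀ i j, ‖A i j‖ ≤ ρ) (u : EuclideanSpace ℂ (Fin N)) :
    quadForm (hadamardPow A (N + m)) u ≤ t * quadForm (entrywise (hPoly c) A) u := by
  -- The same `t` serves in every dimension; this is why it is only required to dominate the
  -- threshold.
  induction N with
  | zero => simp [quadForm]
  | succ N ih =>
    obtain ⟨v, hD, hrow, hcol⟩ := exists_vecMulVec_le hA
    have hv (i) : ‖v i‖ ≤ √ρ := by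
      refine Real.le_sqrt_of_sq_le ?_
      have h1 := (Complex.nonneg_iff.1 (hD.diag_nonneg (i := i))).1
      have h2 := (Complex.re_le_norm _).trans (hAρ i i)
      have h3 : vecMulVec v (star v) i i = ((‖v i‖ ^ 2 : ℝ) : ℂ) := by
        simp [vecMulVec_apply, Complex.mul_conj']
      rw [Matrix.sub_apply, h3, Complex.sub_re, Complex.ofReal_re] at h1
      linarith
    have hvv (i j) : ‖vecMulVec v (star v) i j‖ ≤ ρ := by
      rw [vecMulVec_apply, norm_mul, Pi.star_apply, norm_star, ← Real.mul_self_sqrt hρ.le]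
      exact mul_le_mul (hv i) (hv j) (norm_nonneg _) (Real.sqrt_nonneg _)
    set B := vecMulVec v (star v) with hBdef
    have hB : B.PosSemidef := posSemidef_vecMulVec_self_star v
    set M : ℕ := N + 1 + m with hM
    -- Chosen so that the derivative of `t * h_c - z ^ M` is `M * (t * h_{c'} - z ^ (M - 1))`.
    set c' : Fin N → ℝ := fun j => ((j : ℕ) + 1) * c j.succ / M with hc'
    have hMpos : (0 : ℝ) < M := by rw [hM]; positivity
    have hc'pos (j) : 0 < c' j := by
      have := hc j.succ
      positivity
    have ht' : threshold c' (N + m) ρ ≤ t := (threshold_shift_le hc m hρ).trans ht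
    let F : ℂ → ℂ := fun z => t * hPoly c z - z ^ M
    let F' : ℂ → ℂ := fun z => M * (t * hPoly c' z - z ^ (N + m))
    have hF (z : ℂ) : HasDerivAt F (F' z) z := by
      have h1 : HasDerivAt (hPoly c) (∑ j : Fin (N + 1), (c j : ℂ) * ((j : ℕ) * z ^ ((j : ℕ) - 1)))
          z := HasDerivAt.fun_sum fun j _ => (hasDerivAt_pow (j : ℕ) z).const_mul _
      refine ((h1.const_mul (t : ℂ)).sub (hasDerivAt_pow M z)).congr_deriv (Eq.symm ?_)
      simp only [F', hPoly, hc', Fin.sum_univ_succ]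
      have hMne : (M : ℂ) ≠ 0 := by exact_mod_cast hMpos.ne'
      rw [mul_sub, show M - 1 = N + m by lia]
      congr 1
      simp only [Finset.mul_sum, Fin.val_zero, Nat.cast_zero, zero_mul, mul_zero, zero_add]
      refine Finset.sum_congr rfl fun j _ => ?_
      push_cast
      field_simp
      simp only [Fin.val_succ, Nat.add_sub_cancel]
      push_cast
      ring
    have hFq (X : Matrix (Fin (N + 1)) (Fin (N + 1)) ℂ) : quadForm (entrywise F X) u =
        t * quadForm (entrywise (hPoly c) X) u - quadForm (hadamardPow X M) u := by
      rw [← quadForm_smul, ← quadForm_sub]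
      rfl
    have hle := quadForm_entrywise_le hF hD hrow hcol (fun x hx => ?_) u
    · rw [hFq, hFq] at hle
      have h0 := quadForm_vecMulVec_le hc m hρ hv u
      have h1 := mul_le_mul_of_nonneg_right ht (quadForm_nonneg (hPoly_posSemidef hc hB) u)
      linarith
    · have hG : (B + (x : ℂ) • (A - B)).PosSemidef :=
        hB.add (hD.smul (by exact_mod_cast hx.1))
      have hGs := hG.submatrix (Fin.succ : Fin N → Fin (N + 1))
      have hGρ (i j : Fin (N + 1)) : ‖(B + (x : ℂ) • (A - B)) i j‖ ≤ ρ := by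
        have e : (B + (x : ℂ) • (A - B)) i j = ((1 - x : ℝ) : ℂ) * B i j + (x : ℂ) * A i j := by
          simp only [Matrix.add_apply, Matrix.smul_apply, Matrix.sub_apply, smul_eq_mul]
          push_cast
          ring
        rw [e]
        refine (norm_add_le _ _).trans ?_
        rw [norm_mul, norm_mul, Complex.norm_of_nonneg (sub_nonneg.2 hx.2),
          Complex.norm_of_nonneg hx.1]
        have := mul_le_mul_of_nonneg_left (hvv i j) (sub_nonneg.2 hx.2)
        have := mul_le_mul_of_nonneg_left (hAρ i j) hx.1
        linarith
      have hP := (posSemidef_sub_iff hc'pos hGs t (N + m)).2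
        fun w => ih hc'pos ht' hGs (fun i j => hGρ _ _) w
      have hP' := hP.smul (show (0 : ℂ) ≤ M by positivity)
      convert hP' using 1
      ext i j
      simp [entrywise, F']

/-! ### The kernel and the Rayleigh quotient. -/

theorem exists_forall_quadForm_le {N : ℕ} {c : Fin N → ℝ} (hc : ∀ j, 0 < c j)
    {A : Matrix (Fin N) (Fin N) ℂ} (hA : A.PosSemidef) (m : ℕ) :
    ∃ t : ℝ, ∀ u, quadForm (hadamardPow A (N + m)) u ≤
      t * quadForm (entrywise (hPoly c) A) u := by
  have h0 : 0 ≤ ∑ i, ∑ j, ‖A i j‖ := by positivity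
  refine ⟨_, quadForm_hadamardPow_le hc m (ρ := ∑ i, ∑ j, ‖A i j‖ + 1) (by linarith) le_rfl hA
    fun i j => ?_⟩
  have h1 := Finset.single_le_sum (f := fun j => ‖A i j‖) (fun _ _ => norm_nonneg _)
    (Finset.mem_univ j)
  have h2 := Finset.single_le_sum (f := fun i => ∑ j, ‖A i j‖)
    (fun _ _ => Finset.sum_nonneg fun _ _ => norm_nonneg _) (Finset.mem_univ i)
  exact (h1.trans h2).trans (by simp)

theorem simKernel_eq_iInf {N : ℕ} {c : Fin N → ℝ} (hc : ∀ j, 0 < c j)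
    {A : Matrix (Fin N) (Fin N) ℂ} (hA : A.PosSemidef) :
    simKernel c A = ⨅ n : ℕ, kernel (hadamardPow A n) := by
  ext u
  simp only [Submodule.mem_iInf, ← quadForm_eq_zero_iff (hadamardPow_posSemidef hA _)]
  rw [simKernel, ← quadForm_eq_zero_iff (hPoly_posSemidef hc hA)]
  refine ⟨fun h n => ?_, fun h => by simp [quadForm_hPoly, h]⟩
  rcases lt_or_ge n N with hn | hn
  · rw [quadForm_hPoly, Finset.sum_eq_zero_iff_of_nonneg fun j _ =>
      mul_nonneg (hc j).le (quadForm_nonneg (hadamardPow_posSemidef hA _) u)] at h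
    exact (mul_eq_zero.1 (h ⟨n, hn⟩ (Finset.mem_univ _))).resolve_left (hc _).ne'
  -- Powers `n ≥ N` are dominated by a multiple of `h_c[A]`, so their forms vanish with it.
  · obtain ⟨m, rfl⟩ := Nat.exists_eq_add_of_le hn
    obtain ⟨t, ht⟩ := exists_forall_quadForm_le hc hA m
    refine le_antisymm ?_ (quadForm_nonneg (hadamardPow_posSemidef hA _) u)
    simpa [h] using ht u

theorem quadForm_pos_of_mem_orthogonal {N : ℕ} {c : Fin N → ℝ} (hc : ∀ j, 0 < c j)
    {A : Matrix (Fin N) (Fin N) ℂ} (hA : A.PosSemidef) {u : EuclideanSpace ℂ (Fin N)}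
    (hu : u ∈ (simKernel c A)ᗮ) (hu0 : u ≠ 0) : 0 < quadForm (entrywise (hPoly c) A) u := by
  refine (quadForm_nonneg (hPoly_posSemidef hc hA) u).lt_of_ne' fun h => hu0 ?_
  rw [quadForm_eq_zero_iff (hPoly_posSemidef hc hA)] at h
  have h' : u ∈ simKernel c A ⊓ (simKernel c A)ᗮ := ⟨h, hu⟩
  rwa [Submodule.inf_orthogonal_eq_bot, Submodule.mem_bot] at h'

theorem quadForm_add_of_mem_kernel {N : ℕ} {B : Matrix (Fin N) (Fin N) ℂ} (hB : B.IsHermitian)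
    {k : EuclideanSpace ℂ (Fin N)} (hk : k ∈ kernel B) (w : EuclideanSpace ℂ (Fin N)) :
    quadForm B (k + w) = quadForm B w := by
  have h1 : B *ᵥ k.ofLp = 0 := by
    simpa [kernel, LinearMap.mem_ker, Matrix.toLpLin_apply] using hk
  have h2 : star k.ofLp ᵥ* B = 0 := by
    have := star_mulVec B k.ofLp
    rwa [h1, hB.eq, star_zero, eq_comm] at this
  simp [quadForm, mulVec_add, h1, dotProduct_mulVec, add_vecMul, h2]

/-- The kernel component of a vector affects neither form, so the Loewner inequality need only be
tested on the orthogonal complement, where one may divide. -/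
theorem setOf_posSemidef_eq_upperBounds {N : ℕ} {c : Fin N → ℝ} (hc : ∀ j, 0 < c j)
    {A : Matrix (Fin N) (Fin N) ℂ} (hA : A.PosSemidef) (M : ℕ) :
    {s : ℝ | ∀ A' ∈ ({A} : Set (Matrix (Fin N) (Fin N) ℂ)),
      ((s : ℂ) • entrywise (hPoly c) A' - entrywise (fun z => z ^ M) A').PosSemidef} =
      upperBounds (rayleighValues c M A) := by
  ext s
  simp only [Set.mem_singleton_iff, forall_eq, Set.mem_ofPred_eq, posSemidef_sub_iff hc hA,
    rayleighValues, upperBounds]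
  constructor
  · rintro h _ ⟨u, hu, hu0, rfl⟩
    rw [← entrywise_hPoly, div_le_iff₀ (quadForm_pos_of_mem_orthogonal hc hA hu hu0)]
    exact h u
  · intro h u
    obtain ⟨k, hk, w, hw, rfl⟩ := (simKernel c A).exists_add_mem_mem_orthogonal u
    have hk' : k ∈ kernel (hadamardPow A M) := by
      rw [simKernel_eq_iInf hc hA, Submodule.mem_iInf] at hk
      exact hk M
    rw [quadForm_add_of_mem_kernel (hadamardPow_posSemidef hA M).1 hk',
      quadForm_add_of_mem_kernel (hPoly_posSemidef hc hA).1 hk]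
    by_cases hw0 : w = 0
    · simp [hw0, quadForm]
    · rw [← div_le_iff₀ (quadForm_pos_of_mem_orthogonal hc hA hw hw0), entrywise_hPoly]
      exact h ⟨w, hw, hw0, rfl⟩

/-- The all-ones matrix `A^{∘0}` does not annihilate a basis vector, so the common kernel is proper.
-/
theorem rayleighValues_nonempty {N : ℕ} (hN : 1 ≤ N) {c : Fin N → ℝ} (hc : ∀ j, 0 < c j)
    {A : Matrix (Fin N) (Fin N) ℂ} (hA : A.PosSemidef) (M : ℕ) :
    (rayleighValues c M A).Nonempty := by
  have hne : (simKernel c A)ᗮ ≠ ⊥ := by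
    rw [Ne, Submodule.orthogonal_eq_bot_iff, simKernel_eq_iInf hc hA]
    intro h
    have h0 : EuclideanSpace.single (⟨0, hN⟩ : Fin N) (1 : ℂ) ∈ kernel (hadamardPow A 0) := by
      rw [iInf_eq_top.1 h 0]
      exact Submodule.mem_top
    rw [← quadForm_eq_zero_iff (hadamardPow_posSemidef hA 0)] at h0
    simp [quadForm_eq_sum, hadamardPow_zero] at h0
  obtain ⟨u, hu, hu0⟩ := Submodule.exists_mem_ne_zero_of_ne_bot hne
  exact ⟨_, u, hu, hu0, rfl⟩

theorem isExtremeCriticalValue_iff_isLUB {N : ℕ} {c : Fin N → ℝ} (hc : ∀ j, 0 < c j)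
    {A : Matrix (Fin N) (Fin N) ℂ} (hA : A.PosSemidef) (M : ℕ) (t : ℝ) :
    IsExtremeCriticalValue (hPoly c) (fun z => z ^ M) {A} t ↔ IsLUB (rayleighValues c M A) t := by
  rw [IsExtremeCriticalValue, setOf_posSemidef_eq_upperBounds hc hA, IsLUB]

theorem exists_isLUB_rayleighValues {N : ℕ} (hN : 1 ≤ N) {c : Fin N → ℝ} (hc : ∀ j, 0 < c j)
    {A : Matrix (Fin N) (Fin N) ℂ} (hA : A.PosSemidef) (m : ℕ) :
    ∃ C, IsLUB (rayleighValues c (N + m) A) C := by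
  obtain ⟨t, ht⟩ := exists_forall_quadForm_le hc hA m
  refine ⟨_, isLUB_csSup (rayleighValues_nonempty hN hc hA _) ⟨t, ?_⟩⟩
  rw [← setOf_posSemidef_eq_upperBounds hc hA]
  rintro _ rfl
  exact (posSemidef_sub_iff hc hA t _).2 ht

theorem IsExtremeCriticalValue.le_threshold {N : ℕ} {c : Fin N → ℝ} (hc : ∀ j, 0 < c j)
    {ρ : ℝ} (hρ : 0 < ρ) {A : Matrix (Fin N) (Fin N) ℂ} (hA : A ∈ psd N (Metric.closedBall 0 ρ))
    {m : ℕ} {t : ℝ} (ht : IsExtremeCriticalValue (hPoly c) (fun z => z ^ (N + m)) {A} t) :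
    t ≤ threshold c (N + m) ρ := by
  refine ht.2 ?_
  rintro _ rfl
  refine (posSemidef_sub_iff hc hA.1 _ _).2 (quadForm_hadamardPow_le hc m hρ le_rfl hA.1 ?_)
  simpa using hA.2.2

/-! ### Sharpness. -/

/-- The extreme critical value of a rank-one matrix with distinct nodes is at least the remainder
weight of the nodes. -/
theorem remWeight_le_of_isExtremeCriticalValue {N : ℕ} {c : Fin N → ℝ} (hc : ∀ j, 0 < c j) {m : ℕ}
    {w : ℕ → ℂ} (hw : Function.Injective w) (hpos : 0 < remWeight c m w) {t : ℝ}
    (ht : IsExtremeCriticalValue (hPoly c) (fun z => z ^ (N + m))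
      {vecMulVec (fun i : Fin N => w i) (star fun i : Fin N => w i)} t) :
    remWeight c m w ≤ t := by
  set v : Fin N → ℂ := fun i => w i
  have hdet : IsUnit (vandermonde v).det :=
    (det_vandermonde_ne_zero_iff.2 (hw.comp Fin.val_injective)).isUnit
  -- These moments give equality in Cauchy–Schwarz; inverting the Vandermonde matrix realises them
  -- by a vector.
  set y : Fin N → ℂ := fun j => star (remCoeff w m N j) / c j
  set x : Fin N → ℂ := y ᵥ* (vandermonde v)⁻¹
  have hx : x ᵥ* vandermonde v = y := by
    rw [vecMul_vecMul, nonsing_inv_mul _ hdet, vecMul_one]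
  have hxj (j : Fin N) : ∑ i, x i * w i ^ (j : ℕ) = y j := by
    rw [← hx]
    simp [vecMul, dotProduct, vandermonde_apply, v]
  have key := (posSemidef_sub_iff hc (posSemidef_vecMulVec_self_star v) t (N + m)).1
    (ht.1 _ rfl) (WithLp.toLp 2 (star x))
  simp only [quadForm_hPoly, quadForm_hadamardPow_vecMulVec, Pi.star_apply, star_star] at key
  rw [sum_mul_pow_add w m x] at key
  simp only [v, hxj] at key
  have h1 : ∑ j : Fin N, remCoeff w m N j * y j = (remWeight c m w : ℂ) := by
    rw [remWeight]
    push_cast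
    refine Finset.sum_congr rfl fun j _ => ?_
    rw [← Complex.mul_conj']
    simp only [y, Complex.star_def]
    ring
  have h2 : ∑ j : Fin N, c j * ‖y j‖ ^ 2 = remWeight c m w := by
    refine Finset.sum_congr rfl fun j _ => ?_
    have := (hc j).ne'
    simp only [y, norm_div, norm_star, Complex.norm_real, Real.norm_eq_abs, div_pow, sq_abs]
    field_simp
  -- The inequality becomes `W * W ≤ t * W` with `W = remWeight c m w`.
  rw [h1, h2, Complex.norm_real, Real.norm_eq_abs, sq_abs, sq] at key
  exact le_of_mul_le_mul_right key hpos

theorem threshold_pos {N : ℕ} (hN : 1 ≤ N) {c : Fin N → ℝ} (hc : ∀ j, 0 < c j) {M : ℕ}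
    (hNM : N ≤ M) {ρ : ℝ} (hρ : 0 < ρ) : 0 < threshold c M ρ := by
  have : Nonempty (Fin N) := ⟨⟨0, hN⟩⟩
  refine Finset.sum_pos (fun j _ => ?_) Finset.univ_nonempty
  have := hc j
  have h1 := Nat.choose_pos (show (j : ℕ) ≤ M by lia)
  have h2 := Nat.choose_pos (show N - j - 1 ≤ M - j - 1 by lia)
  positivity

theorem threshold_le_of_mem_upperBounds {N : ℕ} (hN : 1 ≤ N) {c : Fin N → ℝ} (hc : ∀ j, 0 < c j)
    (m : ℕ) {ρ ε : ℝ} (hε : ε ∈ Set.Ioo 0 ρ) {b : ℝ}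
    (hb : b ∈ upperBounds (criticalValues c (N + m)
      (psdRank N 1 (Complex.ofReal '' Set.Ioo (ρ - ε) ρ)))) :
    threshold c (N + m) ρ ≤ b := by
  have hρ : 0 < ρ := hε.1.trans hε.2
  -- For `s > 0` the nodes are distinct and below `√ρ`; they all tend to `√ρ` as `s → 0`.
  let x : ℝ → ℕ → ℝ := fun s i => √ρ - s * (i + 1)
  have hxc (i : ℕ) : Continuous fun s => x s i := by fun_prop
  have hcont : Continuous fun s : ℝ => remWeight c m fun i => (x s i : ℂ) := by
    have h (j : ℕ) := continuous_remCoeff (u := fun s i => (x s i : ℂ))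
      (fun i => Complex.continuous_ofReal.comp (hxc i)) m N j
    simp only [remWeight]
    fun_prop
  have hlim : Tendsto (fun s : ℝ => remWeight c m fun i => (x s i : ℂ)) (𝓝[>] 0)
      (𝓝 (threshold c (N + m) ρ)) := by
    have := (hcont.tendsto 0).mono_left (nhdsWithin_le_nhds (s := Set.Ioi 0))
    simpa [x, remWeight_const c m hρ] using this
  refine le_of_tendsto hlim ?_
  have hev (i : Fin N) : ∀ᶠ s in 𝓝[>] 0, √(ρ - ε) < x s i := by
    refine ((hxc i).tendsto 0).mono_left nhdsWithin_le_nhds |>.eventually_const_lt ?_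
    simpa [x] using Real.sqrt_lt_sqrt (sub_pos.2 hε.2).le (sub_lt_self ρ hε.1)
  filter_upwards [eventually_all.2 hev, self_mem_nhdsWithin,
    hlim.eventually_const_lt (threshold_pos hN hc (Nat.le_add_right N m) hρ)] with s hs hs0 hpos
  have hs0' : 0 < s := hs0
  have hinj : Function.Injective fun i => (x s i : ℂ) := by
    intro i j hij
    have h : x s i = x s j := Complex.ofReal_injective hij
    have h' : s * ((i : ℝ) + 1) = s * (j + 1) := by simp only [x] at h; linarith
    exact_mod_cast add_right_cancel (mul_left_cancel₀ hs0'.ne' h')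
  have hlt (i : ℕ) : x s i < √ρ := sub_lt_self _ (by positivity)
  set v : Fin N → ℂ := fun i => (x s i : ℂ)
  have hA : (vecMulVec v (star v)).PosSemidef := posSemidef_vecMulVec_self_star v
  obtain ⟨C, hC⟩ := exists_isLUB_rayleighValues hN hc hA m
  rw [← isExtremeCriticalValue_iff_isLUB hc hA] at hC
  refine (remWeight_le_of_isExtremeCriticalValue hc hinj hpos hC).trans (hb ⟨_, ⟨hA,
    rank_vecMulVec_le _ _, fun i j => ⟨x s i * x s j, ⟨?_, ?_⟩, ?_⟩⟩, hC⟩)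
  · rw [← Real.mul_self_sqrt (sub_pos.2 hε.2).le]
    exact mul_lt_mul'' (hs i) (hs j) (Real.sqrt_nonneg _) (Real.sqrt_nonneg _)
  · rw [← Real.mul_self_sqrt hρ.le]
    exact mul_lt_mul'' (hlt i) (hlt j) ((Real.sqrt_nonneg _).trans (hs i).le)
      ((Real.sqrt_nonneg _).trans (hs j).le)
  · simp [vecMulVec_apply, v]

theorem psdRank_subset_psd {N : ℕ} {ρ ε : ℝ} (hε : ε ∈ Set.Ioo 0 ρ) :
    psdRank N 1 (Complex.ofReal '' Set.Ioo (ρ - ε) ρ) ⊆ psd N (Metric.closedBall 0 ρ) := by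
  rintro A ⟨hA, -, hAe⟩
  refine ⟨hA, A.rank_le_width, fun i j => ?_⟩
  obtain ⟨y, hy, hy'⟩ := hAe i j
  rw [← hy', mem_closedBall_zero_iff, Complex.norm_real, Real.norm_eq_abs, abs_le]
  constructor <;> linarith [hy.1, hy.2, hε.1, hε.2]

end HadamardRayleigh

theorem proposition3p3 (ρ : ℝ) (hρ : 0 < ρ) (N M : ℕ) (hN : 1 ≤ N) (hNM : N ≤ M)
    (c : Fin N → ℝ) (hc : ∀ j, 0 < c j) :
    -- the kernel, and the extreme critical value of a single matrix
    (∀ A ∈ HadamardRayleigh.psd N Set.univ,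
      HadamardRayleigh.simKernel c A =
          ⨅ n : ℕ, HadamardRayleigh.kernel (HadamardRayleigh.hadamardPow A n) ∧
      -- the Rayleigh quotient has a positive denominator
      (∀ u ∈ (HadamardRayleigh.simKernel c A)ᗮ, u ≠ 0 →
        0 < HadamardRayleigh.quadForm
          (∑ j : Fin N, (c j : ℂ) • HadamardRayleigh.hadamardPow A (j : ℕ)) u) ∧
      ∃ C : ℝ,
        HadamardRayleigh.IsExtremeCriticalValue
          (HadamardRayleigh.hPoly c) (fun z => z ^ M) {A} C ∧
        IsLUB (HadamardRayleigh.rayleighValues c M A) C ∧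
        (A ∈ HadamardRayleigh.psd N (Metric.closedBall 0 ρ) →
          C ≤ HadamardRayleigh.threshold c M ρ)) ∧
    -- the bound is sharp
    IsLUB (HadamardRayleigh.criticalValues c M
        (HadamardRayleigh.psd N (Metric.closedBall 0 ρ)))
      (HadamardRayleigh.threshold c M ρ) ∧
    -- the supremum over rank-one matrices with entries in the interval `(ρ - ε, ρ)`
    ∀ ε ∈ Set.Ioo 0 ρ,
      IsLUB (HadamardRayleigh.criticalValues c M
          (HadamardRayleigh.psdRank N 1 (Complex.ofReal '' Set.Ioo (ρ - ε) ρ)))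
        (HadamardRayleigh.threshold c M ρ) := by
  open HadamardRayleigh in
  obtain ⟨m, rfl⟩ := Nat.exists_eq_add_of_le hNM
  have hub : threshold c (N + m) ρ ∈
      upperBounds (criticalValues c (N + m) (psd N (Metric.closedBall 0 ρ))) := by
    rintro t ⟨A, hA, ht⟩
    exact ht.le_threshold hc hρ hA
  have hmono {ε : ℝ} (hε : ε ∈ Set.Ioo 0 ρ) :
      criticalValues c (N + m) (psdRank N 1 (Complex.ofReal '' Set.Ioo (ρ - ε) ρ)) ⊆
        criticalValues c (N + m) (psd N (Metric.closedBall 0 ρ)) :=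
    fun t ⟨A, hA, ht⟩ => ⟨A, psdRank_subset_psd hε hA, ht⟩
  refine ⟨fun A ⟨hA, _⟩ => ⟨simKernel_eq_iInf hc hA, fun u hu hu0 => ?_, ?_⟩, ⟨hub, fun b hb => ?_⟩,
    fun ε hε => ⟨fun t ht => hub (hmono hε ht),
      fun b hb => threshold_le_of_mem_upperBounds hN hc m hε hb⟩⟩
  · rw [← entrywise_hPoly]
    exact quadForm_pos_of_mem_orthogonal hc hA hu hu0
  · obtain ⟨C, hC⟩ := exists_isLUB_rayleighValues hN hc hA m
    have hC' := (isExtremeCriticalValue_iff_isLUB hc hA _ _).2 hC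
    exact ⟨C, hC', hC, fun hAρ => hC'.le_threshold hc hρ hAρ⟩
  -- The rank-one family, for any one `ε`, already forces the lower bound over the disc.
  · have hε : ρ / 2 ∈ Set.Ioo 0 ρ := ⟨by linarith, by linarith⟩
    exact threshold_le_of_mem_upperBounds hN hc m hε fun t ht => hb (hmono hε ht)
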